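/- **Crude Recognition Theorem.** Let $\mathbb{A}$ be a small category. For a presheaf $Y:\mathbb{A}^{\mathrm{op}}\to\mathbf{Set}$ and a functor $X$ on $\mathbb{A}$ with values in $\mathbf{Set}$ or $\mathbf{Top}$, let $Y\otimes X=\int^{b}Y(b)\times X(b)$, that is, the quotient of $\sum_{b}Y(b)\times X(b)$ by the equivalence relation generated by $(yg,x)\sim(y,gx)$ (with the quotient topology in the case of $\mathbf{Top}$, each set $Y(b)$ being discrete); the class of $(y,x)$ is written $y\otimes x$. A functor $X:\mathbb{A}\to\mathbf{Set}$ is *nondegenerate* if $-\otimes X:[\mathbb{A}^{\mathrm{op}},\mathbf{Set}]\to\mathbf{Set}$ preserves finite connected limits; a functor $X:\mathbb{A}\to\mathbf{Top}$ is *nondegenerate* if its underlying $\mathbf{Set}$-valued functor is nondegenerate and $Xf$ is a closed map for every arrow $f$ of $\mathbb{A}$. An *equational system* $(\mathbb{A},M)$ is a small category $\mathbb{A}$ together with a functor $M:\mathbb{A}^{\mathrm{op}}\times\mathbb{A}\to\mathbf{Set}$ such that for each $a$ the category of elements of $M(-,a)$ is finite, and for each $b$ the functor $M(b,-)$ is nondegenerate.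 An element $m\in M(b,a)$ is called a *sector* $m:b\to a$. For $X:\mathbb{A}\to\mathbf{Top}$ let $M\otimes X:\mathbb{A}\to\mathbf{Top}$ be given by $(M\otimes X)(a)=M(-,a)\otimes X$. An *$M$-coalgebra in $\mathbf{Top}$* is a pair $(X,\xi)$ of a nondegenerate functor $X:\mathbb{A}\to\mathbf{Top}$ and a natural transformation $\xi:X\to M\otimes X$; a map $(X,\xi)\to(X',\xi')$ is a natural transformation $\omega:X\to X'$ with $\xi'\circ\omega=(M\otimes\omega)\circ\xi$. A *fixed point* of $M$ is a coalgebra $(J,\gamma)$ with $\gamma$ an isomorphism; then, writing $\psi=\gamma^{-1}$, each sector $m:b\to a$ induces the continuous map $\psi_m:J(b)\to J(a)$, $\psi_m(x)=\psi_a(m\otimes x)$. A *universal solution* in $\mathbf{Top}$ is a terminal object of the category of $M$-coalgebras in $\mathbf{Top}$. Let $(\mathbb{A},M)$ be an equational system with $\mathbb{A}$ finite (finitely many objects and arrows), and let $(J,\gamma=\psi^{-1})$ be a fixed point of $M$ in $\mathbf{Top}$ such that for each $a\in\mathbb{A}$ the space $J(a)$ is nonempty and compact. Suppose that the spaces $J(a)$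 admit metrics, inducing their topologies, such that for each sector $m:b\to a$ the map $\psi_m:J(b)\to J(a)$ is a contraction, that is, there is a constant $\lambda_m<1$ with $d(\psi_m(x),\psi_m(y))\le\lambda_m\,d(x,y)$ for all $x,y\in J(b)$. Then $(J,\gamma)$ is the universal solution of $(\mathbb{A},M)$ in $\mathbf{Top}$. -/

import Mathlib

open CategoryTheory CategoryTheory.Limits Opposite

universe u

noncomputable section

namespace EqSys

variable {A : Type u} [SmallCategory A]

section Tensor

/-- The generating relation of `Y ⊗ X = (∑_b Y(b) × X(b)) / ∼`, for a presheaf `Y` and a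
covariant functor `X`: `(yg, x) ∼ (y, gx)` for `g : b' ⟶ b`, `y ∈ Y(b)`, `x ∈ X(b')`. -/
inductive TensorRel (Y : Aᵒᵖ ⥤ Type u) (X : A ⥤ Type u) :
    (Σ (b : A) (_ : Y.obj (op b)), X.obj b) → (Σ (b : A) (_ : Y.obj (op b)), X.obj b) → Prop
  | glue {b' b : A} (g : b' ⟶ b) (y : Y.obj (op b)) (x : X.obj b') :
      TensorRel Y X ⟨b', Y.map g.op y, x⟩ ⟨b, y, X.map g x⟩

/-- The tensor product `Y ⊗ X = ∫^b Y(b) × X(b)` of sets. -/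
def Tensor (Y : Aᵒᵖ ⥤ Type u) (X : A ⥤ Type u) : Type u :=
  Quot (TensorRel Y X)

/-- The element `y ⊗ x` of `Y ⊗ X`. -/
def Tensor.tmul (Y : Aᵒᵖ ⥤ Type u) (X : A ⥤ Type u) {b : A} (y : Y.obj (op b)) (x : X.obj b) :
    Tensor Y X :=
  Quot.mk _ ⟨b, y, x⟩

/-- Functoriality of `Y ⊗ X` in both variables: `y ⊗ x ↦ α y ⊗ β x`. -/
def Tensor.map {Y Y' : Aᵒᵖ ⥤ Type u} {X X' : A ⥤ Type u} (α : Y ⟶ Y') (β : X ⟶ X') :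
    Tensor Y X → Tensor Y' X' :=
  Quot.lift (fun p => Tensor.tmul Y' X' (α.app (op p.1) p.2.1) (β.app p.1 p.2.2)) <| by
    rintro _ _ ⟨g, y, x⟩
    have h : TensorRel Y' X' _ _ := .glue g (α.app _ y) (β.app _ x)
    have h' := Quot.sound h
    rw [← NatTrans.naturality_apply, ← NatTrans.naturality_apply] at h'
    exact h'

theorem Tensor.ind {Y : Aᵒᵖ ⥤ Type u} {X : A ⥤ Type u} {P : Tensor Y X → Prop}
    (h : ∀ (b : A) (y : Y.obj (op b)) (x : X.obj b), P (Tensor.tmul Y X y x))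
    (t : Tensor Y X) : P t :=
  Quot.ind (fun p => h p.1 p.2.1 p.2.2) t

/-- The functor `- ⊗ X : [Aᵒᵖ, Set] ⥤ Set`. -/
def tensorFunctor (X : A ⥤ Type u) : (Aᵒᵖ ⥤ Type u) ⥤ Type u where
  obj Y := Tensor Y X
  map α := TypeCat.ofHom (Tensor.map α (𝟙 X))
  map_id Y := by
    ext t
    induction t using Tensor.ind with
    | h b y x => rfl
  map_comp α β := by
    ext t
    induction t using Tensor.ind with
    | h b y x => rfl

end Tensor

section Nondegenerate

/-- A functor `X : A ⥤ Set` is nondegenerate (componentwise flat) if `- ⊗ X` preserves finite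
connected limits. -/
def Nondegenerate (X : A ⥤ Type u) : Prop :=
  ∀ (K : Type) [SmallCategory K] [FinCategory K] [IsConnected K],
    PreservesLimitsOfShape K (tensorFunctor X)

/-- A functor `X : A ⥤ Top` is nondegenerate if its underlying `Set`-valued functor is, and each
map `X f` is closed. -/
def NondegenerateTop (X : A ⥤ TopCat.{u}) : Prop :=
  Nondegenerate (X ⋙ forget TopCat.{u}) ∧
    ∀ ⦃a a' : A⦄ (f : a ⟶ a'), IsClosedMap (X.map f)

/-- A presheaf is finite if its category of elements is finite. -/
def FinitePresheaf (Y : Aᵒᵖ ⥤ Type u) : Prop :=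
  Finite Y.Elements ∧ ∀ p q : Y.Elements, Finite (p ⟶ q)

end Nondegenerate

/-- An equational system on a small category `A`: a module `M : A ⇸ A` (a functor
`Aᵒᵖ × A ⥤ Set`, here in the curried form `a ↦ M(-, a)`) that is finite (each presheaf `M(-, a)`
is finite) and nondegenerate (each functor `M(b, -)` is nondegenerate). -/
structure EquationalSystem (A : Type u) [SmallCategory A] where
  M : Profunctor.{u} A A
  finite : ∀ a : A, FinitePresheaf (M.obj a)
  nondegenerate : ∀ b : A, Nondegenerate (M.flip.obj (op b))

namespace EquationalSystem

/-- The set `M(b, a)` of sectors of type `b` in `a`. -/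
abbrev Sector (E : EquationalSystem A) (b a : A) : Type u :=
  (E.M.obj a).obj (op b)

end EquationalSystem

section TopTensor

/-- The quotient map `∑_{b, y ∈ Y(b)} X(b) → Y ⊗ UX`, for `X : A ⥤ Top`. -/
def topTensorMk (Y : Aᵒᵖ ⥤ Type u) (X : A ⥤ TopCat.{u})
    (p : Σ (b : A) (_ : Y.obj (op b)), X.obj b) : Tensor Y (X ⋙ forget TopCat.{u}) :=
  Tensor.tmul Y (X ⋙ forget TopCat.{u}) p.2.1 p.2.2

/-- The quotient topology on `Y ⊗ UX` from the topological sum `∑_{b, y ∈ Y(b)} X(b)`. -/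
instance topTensorTopology (Y : Aᵒᵖ ⥤ Type u) (X : A ⥤ TopCat.{u}) :
    TopologicalSpace (Tensor Y (X ⋙ forget TopCat.{u})) :=
  TopologicalSpace.coinduced (topTensorMk Y X) inferInstance

/-- The tensor product `Y ⊗ X` in `Top`, for a presheaf of sets `Y` and `X : A ⥤ Top`. -/
def topTensor (Y : Aᵒᵖ ⥤ Type u) (X : A ⥤ TopCat.{u}) : TopCat.{u} :=
  TopCat.of (Tensor Y (X ⋙ forget TopCat.{u}))

/-- The coprojection `y ⊗ - : X(b) ⟶ Y ⊗ X`. -/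
def topTensorCoproj (Y : Aᵒᵖ ⥤ Type u) (X : A ⥤ TopCat.{u}) {b : A} (y : Y.obj (op b)) :
    X.obj b ⟶ topTensor Y X :=
  @TopCat.ofHom (X.obj b) (Tensor Y (X ⋙ forget TopCat.{u})) _ _
    { toFun := fun x => topTensorMk Y X ⟨b, y, x⟩
      continuous_toFun :=
        (continuous_coinduced_rng (f := topTensorMk Y X)).comp
          ((continuous_sigmaMk (σ := fun b : A => Σ (_ : Y.obj (op b)), X.obj b) (i := b)).comp
            (continuous_sigmaMk (σ := fun _ : Y.obj (op b) => X.obj b) (i := y))) }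

/-- A map out of `Y ⊗ X` is continuous as soon as its composites with all the coprojections
`y ⊗ -` are. -/
theorem continuous_topTensor {Y : Aᵒᵖ ⥤ Type u} {X : A ⥤ TopCat.{u}} {Z : Type*}
    [TopologicalSpace Z] (f : topTensor Y X → Z)
    (hf : ∀ (b : A) (y : Y.obj (op b)), Continuous (fun x => f (topTensorCoproj Y X y x))) :
    Continuous f :=
  continuous_coinduced_dom.2 <| continuous_sigma fun b => continuous_sigma fun y => hf b y

/-- Functoriality of `Y ⊗ X` in both variables, in `Top`. -/
def topTensorMap {Y Y' : Aᵒᵖ ⥤ Type u} {X X' : A ⥤ TopCat.{u}} (α : Y ⟶ Y') (β : X ⟶ X') :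
    topTensor Y X ⟶ topTensor Y' X' :=
  @TopCat.ofHom (topTensor Y X) (topTensor Y' X') _ _
    { toFun := Tensor.map α (Functor.whiskerRight β (forget TopCat.{u}))
      continuous_toFun := continuous_topTensor _ fun b y =>
        (topTensorCoproj Y' X' (α.app (op b) y)).hom.continuous.comp (β.app b).hom.continuous }

theorem topTensor_hom_ext {Y : Aᵒᵖ ⥤ Type u} {X : A ⥤ TopCat.{u}} {Z : TopCat.{u}}
    {f g : topTensor Y X ⟶ Z}
    (h : ∀ (b : A) (y : Y.obj (op b)) (x : X.obj b),
      f (topTensorCoproj Y X y x) = g (topTensorCoproj Y X y x)) : f = g :=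
  TopCat.ext fun t => Tensor.ind (P := fun t => f t = g t) h t

end TopTensor

namespace EquationalSystem

variable (E : EquationalSystem A)

/-- The endofunctor `M ⊗ -` of `[A, Top]`, with `(M ⊗ X)(a) = M(-, a) ⊗ X`. -/
def tensor : (A ⥤ TopCat.{u}) ⥤ (A ⥤ TopCat.{u}) where
  obj X :=
    { obj := fun a => topTensor (E.M.obj a) X
      map := fun f => topTensorMap (E.M.map f) (𝟙 X)
      map_id := fun a => topTensor_hom_ext fun b m x => by
        rw [E.M.map_id]; rfl
      map_comp := fun f g => topTensor_hom_ext fun b m x => by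
        rw [E.M.map_comp]; rfl }
  map β :=
    { app := fun a => topTensorMap (𝟙 (E.M.obj a)) β
      naturality := fun _ _ _ => topTensor_hom_ext fun _ _ _ => rfl }
  map_id X := by
    ext a : 2
    exact topTensor_hom_ext fun _ _ _ => rfl
  map_comp β γ := by
    ext a : 2
    exact topTensor_hom_ext fun _ _ _ => rfl

/-- The map `m ⊗ - : X(b) ⟶ (M ⊗ X)(a)` of a sector `m : b ⇸ a`. -/
def coproj (X : A ⥤ TopCat.{u}) {b a : A} (m : E.Sector b a) :
    X.obj b ⟶ (E.tensor.obj X).obj a :=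
  topTensorCoproj (E.M.obj a) X m

/-- The category of `M`-coalgebras in `Top`: pairs `(X, ξ)` of a nondegenerate functor
`X : A ⥤ Top` and a natural transformation `ξ : X ⟶ M ⊗ X`, with all coalgebra maps between them.
Since the nondegenerate functors form a full subcategory of `[A, Top]`, these are the coalgebras
of the restriction of `M ⊗ -` to that subcategory. -/
abbrev TopCoalgebra : Type (u + 1) :=
  ObjectProperty.FullSubcategory
    (fun X : Endofunctor.Coalgebra E.tensor => NondegenerateTop X.V)

namespace TopCoalgebra

variable {E}

/-- The underlying functor `A ⥤ Top` of a coalgebra. -/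
abbrev functor (J : E.TopCoalgebra) : A ⥤ TopCat.{u} := J.obj.V

/-- The structure map `J ⟶ M ⊗ J` of a coalgebra. -/
abbrev str (J : E.TopCoalgebra) : J.functor ⟶ E.tensor.obj J.functor := J.obj.str

/-- A fixed point is a coalgebra whose structure map is an isomorphism. -/
def IsFixedPoint (J : E.TopCoalgebra) : Prop := IsIso J.str

/-- A universal solution in `Top` is a terminal `M`-coalgebra. -/
def IsUniversalSolution (J : E.TopCoalgebra) : Prop := Nonempty (IsTerminal J)

/-- For a fixed point `(J, γ)` with `ψ = γ⁻¹`, the map `ψ_m : J(b) ⟶ J(a)` induced by a sector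
`m : b ⇸ a`, that is, `ψ_a ∘ (m ⊗ -)`. -/
def sectorMap (J : E.TopCoalgebra) (hJ : J.IsFixedPoint) {b a : A} (m : E.Sector b a) :
    J.functor.obj b ⟶ J.functor.obj a :=
  E.coproj J.functor m ≫ (@inv _ _ _ _ J.str hJ).app a

/-- The spaces `J(a)` can be metrized, by metrics `d a` inducing their given topologies, so that
every map induced by a sector is a contraction (Lipschitz with a constant `< 1`, which may depend
on the sector). -/
def HasContractingMetrics (J : E.TopCoalgebra) (hJ : J.IsFixedPoint) : Prop :=
  ∃ d : ∀ a : A, MetricSpace (J.functor.obj a),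
    (∀ a : A, (d a).toUniformSpace.toTopologicalSpace = (J.functor.obj a).str) ∧
    ∀ (b a : A) (m : E.Sector b a), ∃ c : ℝ, 0 ≤ c ∧ c < 1 ∧
      ∀ x y : J.functor.obj b,
        (d a).dist (J.sectorMap hJ m x) (J.sectorMap hJ m y) ≤ c * (d b).dist x y

end TopCoalgebra

end EquationalSystem

end EqSys

end

/-!
Let `(J, ψ⁻¹)` be the fixed point and `(X, ξ)` any coalgebra. A coalgebra map `X ⟶ J` is a continuous
fixed point of the operator `ω ↦ ψ ∘ (M ⊗ ω) ∘ ξ` on natural transformations. If `ξ x = m ⊗ x'` then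
this operator replaces `ω x` by `ψ_m (ω x')`; there are finitely many sectors, so the `ψ_m` have a
common ratio `c < 1`, and the operator is a contraction for the uniform distance
(`EquationalSystem.TopCoalgebra.eq_of_step_eq` gives uniqueness). What is not clear is that there is
any continuous natural transformation to start the iteration from. This is avoided by iterating
first among transformations of the underlying sets, and proving continuity of the limit afterwards.

* A natural transformation of sets exists because `X` is nondegenerate: the connected components of
  its category of elements are cofiltered and, `A` being finite, they are finite; so the identity
  functor of each has a cone, and its vertex may be sent to any element of `J` over the same object
  (`Nondegenerate.exists_natTrans`).
* The limit `ω` of the iterates satisfies `ω x = ψ_m (ω x')` (`exists_step_eq`).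
* Nondegeneracy also decides when `m ⊗ x = m' ⊗ x'`, namely when both come from a common `z` along a
  span (`Nondegenerate.exists_span`). As the maps `X f` are closed, so are the coprojections
  `m ⊗ - : X(b) → (M ⊗ X)(a)` (`NondegenerateTop.isClosedMap_topTensorCoproj`). Hence, if `y` is
  close to `x`, then `ξ y = m ⊗ y'` with `y'` close to some `x'` such that `ξ x = m ⊗ x'`; so a bound
  for the oscillation of `ω` at all points improves by the factor `c`, and the oscillation vanishes
  (`continuous_of_step_eq`).
-/

namespace EqSys

variable {A : Type u} [SmallCategory A]

/-! ### Equality in a tensor product with a nondegenerate functor -/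

theorem Tensor.glue {Y : Aᵒᵖ ⥤ Type u} {X : A ⥤ Type u} {b' b : A} (g : b' ⟶ b)
    (y : Y.obj (op b)) (x : X.obj b') :
    Tensor.tmul Y X (Y.map g.op y) x = Tensor.tmul Y X y (X.map g x) :=
  Quot.sound (.glue g y x)

/-- The evaluation `A(-, a) ⊗ X → X(a)`, `h ⊗ z ↦ X(h)(z)` (the co-Yoneda bijection). -/
def Tensor.yonedaEval (X : A ⥤ Type u) (a : A) : Tensor (yoneda.obj a) X → X.obj a :=
  Quot.lift (fun p => X.map (show p.1 ⟶ a from p.2.1) p.2.2) <| by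
    rintro _ _ ⟨g, y, x⟩
    exact ConcreteCategory.congr_hom (X.map_comp g y) x

theorem Tensor.yonedaEval_id (X : A ⥤ Type u) {a : A} (x : X.obj a) :
    Tensor.yonedaEval X a (Tensor.tmul (yoneda.obj a) X (𝟙 a) x) = x :=
  ConcreteCategory.congr_hom (X.map_id a) x

theorem tensorFunctor_map_yonedaEquiv_symm {Y : Aᵒᵖ ⥤ Type u} (X : A ⥤ Type u) {a : A}
    (y : Y.obj (op a)) (x : X.obj a) :
    (tensorFunctor X).map (yonedaEquiv.symm y) (Tensor.tmul (yoneda.obj a) X (𝟙 a) x) =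
      Tensor.tmul Y X y x :=
  congrArg (fun w => Tensor.tmul Y X w x) (ConcreteCategory.congr_hom (Y.map_id (op a)) y)

/-- The functor `- ⊗ X` preserves the pullback of the maps `A(-, a) ⟶ Y ⟵ A(-, a')` that classify `y`
and `y'`, and its elements are the commuting spans. -/
theorem Nondegenerate.exists_span {X : A ⥤ Type u} (hX : Nondegenerate X) {Y : Aᵒᵖ ⥤ Type u}
    {a a' : A} {y : Y.obj (op a)} {y' : Y.obj (op a')} {x : X.obj a} {x' : X.obj a'}
    (h : Tensor.tmul Y X y x = Tensor.tmul Y X y' x') :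
    ∃ (c : A) (f : c ⟶ a) (f' : c ⟶ a') (z : X.obj c),
      Y.map f.op y = Y.map f'.op y' ∧ X.map f z = x ∧ X.map f' z = x' := by
  have := hX WalkingCospan
  have hp := (IsPullback.of_hasPullback (yonedaEquiv.symm y) (yonedaEquiv.symm y')).map
    (tensorFunctor X)
  have e : (tensorFunctor X).map (yonedaEquiv.symm y) (Tensor.tmul (yoneda.obj a) X (𝟙 a) x) =
      (tensorFunctor X).map (yonedaEquiv.symm y')
        (Tensor.tmul (yoneda.obj a') X (𝟙 a') x') :=
    (tensorFunctor_map_yonedaEquiv_symm X _ _).trans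
      (h.trans (tensorFunctor_map_yonedaEquiv_symm X _ _).symm)
  let t := (PullbackCone.IsLimit.equivPullbackObj hp.isLimit).symm ⟨(_, _), e⟩
  have h1 := PullbackCone.IsLimit.equivPullbackObj_symm_apply_fst hp.isLimit ⟨(_, _), e⟩
  have h2 := PullbackCone.IsLimit.equivPullbackObj_symm_apply_snd hp.isLimit ⟨(_, _), e⟩
  change (tensorFunctor X).map (pullback.fst _ _) t = _ at h1
  change (tensorFunctor X).map (pullback.snd _ _) t = _ at h2
  generalize t = t at h1 h2
  induction t using Tensor.ind with
  | h c q z =>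
    refine ⟨c, (pullback.fst (yonedaEquiv.symm y) (yonedaEquiv.symm y')).app (op c) q,
      (pullback.snd (yonedaEquiv.symm y) (yonedaEquiv.symm y')).app (op c) q, z, ?_, ?_, ?_⟩
    · exact ConcreteCategory.congr_hom (NatTrans.congr_app
        (pullback.condition (f := yonedaEquiv.symm y) (g := yonedaEquiv.symm y')) (op c)) q
    -- The evaluation sends the image of `q ⊗ z` under `α ⊗ X` to `X(α q)(z)` by definition.
    · exact (congrArg (Tensor.yonedaEval X a) h1).trans (Tensor.yonedaEval_id X _)
    · exact (congrArg (Tensor.yonedaEval X a') h2).trans (Tensor.yonedaEval_id X _)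

/-- The same for the equalizer of the two maps `A(-, a) ⟶ Y` that classify `y` and `y'`: here a single
arrow `f` works on both sides. -/
theorem Nondegenerate.exists_equalizing {X : A ⥤ Type u} (hX : Nondegenerate X)
    {Y : Aᵒᵖ ⥤ Type u} {a : A} {y y' : Y.obj (op a)} {x : X.obj a}
    (h : Tensor.tmul Y X y x = Tensor.tmul Y X y' x) :
    ∃ (c : A) (f : c ⟶ a) (z : X.obj c), Y.map f.op y = Y.map f.op y' ∧ X.map f z = x := by
  have := hX WalkingParallelPair
  let α : yoneda.obj a ⟶ Y := yonedaEquiv.symm y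
  let β : yoneda.obj a ⟶ Y := yonedaEquiv.symm y'
  have e : (tensorFunctor X).map α (Tensor.tmul (yoneda.obj a) X (𝟙 a) x) =
      (tensorFunctor X).map β (Tensor.tmul (yoneda.obj a) X (𝟙 a) x) :=
    (tensorFunctor_map_yonedaEquiv_symm X _ _).trans
      (h.trans (tensorFunctor_map_yonedaEquiv_symm X _ _).symm)
  obtain ⟨t, ht, -⟩ := Types.unique_of_type_equalizer _ _
    (isLimitForkMapOfIsLimit (tensorFunctor X) (equalizer.condition α β)
      (equalizerIsEqualizer α β)) _ e
  induction t using Tensor.ind with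
  | h c q z =>
    refine ⟨c, (equalizer.ι α β).app (op c) q, z, ?_, ?_⟩
    · exact ConcreteCategory.congr_hom (NatTrans.congr_app (equalizer.condition α β) (op c)) q
    · exact (congrArg (Tensor.yonedaEval X a) ht).trans (Tensor.yonedaEval_id X _)

/-! ### Set-valued transformations out of a nondegenerate functor -/

/-- Two elements of a nondegenerate functor in the same connected component have a common source. -/
theorem Nondegenerate.exists_hom_hom_of_zigzag {X : A ⥤ Type u} (hX : Nondegenerate X)
    {p q : X.Elements} (h : Zigzag p q) : ∃ r : X.Elements, Nonempty (r ⟶ p) ∧ Nonempty (r ⟶ q) := by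
  induction h with
  | refl => exact ⟨p, ⟨𝟙 p⟩, ⟨𝟙 p⟩⟩
  | @tail q s _ hqs ih =>
    obtain ⟨r, hrp, ⟨g⟩⟩ := ih
    rcases hqs with ⟨⟨f⟩⟩ | ⟨⟨f⟩⟩
    · exact ⟨r, hrp, ⟨g ≫ f⟩⟩
    · -- With `g : r ⟶ q` and `f : s ⟶ q`, both `g ⊗ r` and `f ⊗ s` are `𝟙 ⊗ q` in `A(-, q) ⊗ X`.
      have e : Tensor.tmul (yoneda.obj q.1) X (g.1 : r.1 ⟶ q.1) r.2 =
          Tensor.tmul (yoneda.obj q.1) X (f.1 : s.1 ⟶ q.1) s.2 := by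
        have h1 := Tensor.glue (Y := yoneda.obj q.1) (X := X) g.1 (𝟙 q.1) r.2
        have h2 := Tensor.glue (Y := yoneda.obj q.1) (X := X) f.1 (𝟙 q.1) s.2
        rw [g.2] at h1
        rw [f.2] at h2
        simpa using h1.trans h2.symm
      obtain ⟨c, k, k', z, -, hk, hk'⟩ := hX.exists_span e
      obtain ⟨l⟩ := hrp
      exact ⟨⟨c, z⟩, ⟨(⟨k, hk⟩ : X.elementsMk c z ⟶ r) ≫ l⟩, ⟨⟨k', hk'⟩⟩⟩

theorem Nondegenerate.exists_equalizing_hom {X : A ⥤ Type u} (hX : Nondegenerate X)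
    {p q : X.Elements} (f g : p ⟶ q) : ∃ (r : X.Elements) (k : r ⟶ p), k ≫ f = k ≫ g := by
  have e : Tensor.tmul (yoneda.obj q.1) X (f.1 : p.1 ⟶ q.1) p.2 =
      Tensor.tmul (yoneda.obj q.1) X (g.1 : p.1 ⟶ q.1) p.2 := by
    have h1 := Tensor.glue (Y := yoneda.obj q.1) (X := X) f.1 (𝟙 q.1) p.2
    have h2 := Tensor.glue (Y := yoneda.obj q.1) (X := X) g.1 (𝟙 q.1) p.2
    rw [f.2] at h1
    rw [g.2] at h2
    simpa using h1.trans h2.symm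
  obtain ⟨c, k, z, hk, hz⟩ := hX.exists_equalizing e
  exact ⟨⟨c, z⟩, ⟨k, hz⟩, Subtype.ext hk⟩

/-- The connected components of the category of elements of a nondegenerate functor are
cofiltered: a nondegenerate functor is a sum of flat ones. -/
theorem Nondegenerate.isCofiltered_component {X : A ⥤ Type u} (hX : Nondegenerate X)
    (j : ConnectedComponents X.Elements) : IsCofiltered j.Component where
  cone_objs p q := by
    obtain ⟨r, ⟨f⟩, ⟨g⟩⟩ := hX.exists_hom_hom_of_zigzag
      (Quotient.exact' (p.property.trans q.property.symm))
    exact ⟨⟨r, (Quotient.sound' (Zigzag.of_hom f)).trans p.property⟩, ⟨f⟩, ⟨g⟩, trivial⟩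
  cone_maps p q f g := by
    obtain ⟨r, k, hk⟩ := hX.exists_equalizing_hom f.hom g.hom
    exact ⟨⟨r, (Quotient.sound' (Zigzag.of_hom k)).trans p.property⟩, ⟨k⟩,
      ObjectProperty.hom_ext _ hk⟩

/-- Any finite set of objects of a component has a common source `i`, and is then bounded by the
number of arrows out of `i`, so that the component is finite. -/
theorem Nondegenerate.finite_component [FinCategory A] {X : A ⥤ Type u} (hX : Nondegenerate X)
    (j : ConnectedComponents X.Elements) : Finite j.Component := by
  have := hX.isCofiltered_component j
  by_contra hinf
  rw [not_finite_iff_infinite] at hinf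
  obtain ⟨S, hS⟩ := Infinite.exists_subset_card_eq j.Component
    (Nat.card (Σ a b : A, (a ⟶ b)) + 1)
  obtain ⟨i, hi⟩ := IsCofiltered.inf_objs_exists S
  have φ : ∀ p : S, i ⟶ p.1 := fun p => (hi p.2).some
  -- An object with an arrow from `i` is determined by the underlying arrow of `A`.
  have hinj : Function.Injective
      (fun p : S => (⟨i.obj.1, p.1.obj.1, (φ p).hom.1⟩ : Σ a b : A, (a ⟶ b))) := by
    intro p q hpq
    have hobj : p.1.obj = q.1.obj := by
      have key : (⟨p.1.obj.1, X.map (φ p).hom.1 i.obj.2⟩ : Σ a : A, X.obj a) =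
          ⟨q.1.obj.1, X.map (φ q).hom.1 i.obj.2⟩ := by
        have h3 := eq_of_heq (Sigma.mk.inj hpq).2
        exact congrArg (fun s : Σ b : A, (i.obj.1 ⟶ b) =>
          (⟨s.1, X.map s.2 i.obj.2⟩ : Σ a : A, X.obj a)) h3
      rw [(φ p).hom.2, (φ q).hom.2] at key
      exact key
    exact Subtype.ext (ObjectProperty.FullSubcategory.ext hobj)
  have := Nat.card_le_card_of_injective _ hinj
  rw [Nat.card_eq_fintype_card (α := S), Fintype.card_coe] at this
  omega

/-- A nondegenerate functor on a finite category maps to any functor with nonempty values: a cone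
over the identity functor of each component reduces the choice to one value, at its vertex. -/
theorem Nondegenerate.exists_natTrans [FinCategory A] {X : A ⥤ Type u} (hX : Nondegenerate X)
    (J : A ⥤ Type u) (hJ : ∀ a, Nonempty (J.obj a)) : Nonempty (X ⟶ J) := by
  have cone : ∀ j : ConnectedComponents X.Elements, Nonempty (Cone (𝟭 j.Component)) := by
    intro j
    have := hX.isCofiltered_component j
    have := hX.finite_component j
    have : ∀ p q : j.Component, Finite (p ⟶ q) := fun p q =>
      Finite.of_injective (fun f => f.hom.1) fun f g h =>
        ObjectProperty.hom_ext _ (Subtype.ext h)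
    let _ : FinCategory j.Component :=
      { fintypeObj := Fintype.ofFinite _, fintypeHom := fun _ _ => Fintype.ofFinite _ }
    exact IsCofiltered.cone_nonempty _
  let K := fun j => (cone j).some
  let v : ∀ j, J.obj (K j).pt.obj.1 := fun j => (hJ _).some
  have hnat : ∀ (j : ConnectedComponents X.Elements) (p q : j.Component) (f : p ⟶ q),
      J.map f.hom.1 (J.map ((K j).π.app p).hom.1 (v j)) =
        J.map ((K j).π.app q).hom.1 (v j) := by
    intro j p q f
    rw [← (K j).w f]
    exact (ConcreteCategory.congr_hom (J.map_comp _ _) _).symm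
  -- The component is a variable here: those of `x` and `X f x` are equal, but not definitionally.
  let w : ∀ (j : ConnectedComponents X.Elements) (p : X.Elements),
    CategoryTheory.ConnectedComponents.mk p = j → J.obj p.1 :=
    fun j p hp => J.map ((K j).π.app ⟨p, hp⟩).hom.1 (v j)
  refine ⟨{ app := fun a => TypeCat.ofHom fun x => w _ (X.elementsMk a x) rfl
            naturality := ?_ }⟩
  intro a b f
  ext x
  let p : X.Elements := X.elementsMk a x
  let q : X.Elements := X.elementsMk b (X.map f x)
  let g : p ⟶ q := ⟨f, rfl⟩
  have hq : CategoryTheory.ConnectedComponents.mk q = CategoryTheory.ConnectedComponents.mk p :=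
    (Quotient.sound' (Zigzag.of_hom g)).symm
  have hw : ∀ j (h : CategoryTheory.ConnectedComponents.mk q = j), w _ q rfl = w j q h := by
    rintro _ rfl; rfl
  exact (hw _ hq).trans
    (hnat _ ⟨p, rfl⟩ ⟨q, hq⟩ ⟨g⟩).symm

/-! ### Closedness of the coprojections -/

open Topology Filter

theorem NondegenerateTop.isClosedMap_topTensorCoproj [FinCategory A] {X : A ⥤ TopCat.{u}}
    (hX : NondegenerateTop X) (Y : Aᵒᵖ ⥤ Type u) {b : A} (y : Y.obj (op b)) :
    IsClosedMap (topTensorCoproj Y X y) := by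
  intro C hC
  -- The preimage of `y ⊗ C` in the summand of `y'` is a union, over the finitely many spans
  -- `b ⟵ c ⟶ b'` on which `y` and `y'` agree, of the images of `C` along the span.
  refine isClosed_coinduced.2 ?_
  refine isClosed_sigma_iff.2 fun b' => isClosed_sigma_iff.2 fun y' => ?_
  change IsClosed {x' : X.obj b' | ∃ x ∈ C, topTensorCoproj Y X y x = topTensorMk Y X ⟨b', y', x'⟩}
  have : {x' : X.obj b' | ∃ x ∈ C, topTensorCoproj Y X y x = topTensorMk Y X ⟨b', y', x'⟩} =
      ⋃ s : {s : Σ c : A, (c ⟶ b) × (c ⟶ b') // Y.map s.2.1.op y = Y.map s.2.2.op y'},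
        X.map s.1.2.2 '' (X.map s.1.2.1 ⁻¹' C) := by
    ext x'
    simp only [Set.mem_ofPred_eq, Set.mem_preimage, Set.mem_image, Set.mem_iUnion]
    constructor
    · rintro ⟨x, hx, h⟩
      obtain ⟨c, f, f', z, hy, hz, hz'⟩ := hX.1.exists_span
        (y := y) (y' := y') (x := x) (x' := x') h
      refine ⟨⟨⟨c, f, f'⟩, hy⟩, z, ?_, hz'⟩
      change X.map f z = x at hz
      rwa [hz]
    · rintro ⟨⟨⟨c, f, f'⟩, hy⟩, z, hz, rfl⟩
      refine ⟨_, hz, ?_⟩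
      have h1 := Tensor.glue (X := X ⋙ forget TopCat.{u}) f y z
      have h2 := Tensor.glue (X := X ⋙ forget TopCat.{u}) f' y' z
      rw [show Y.map f.op y = Y.map f'.op y' from hy] at h1
      exact h1.symm.trans h2
  rw [this]
  exact isClosed_iUnion_of_finite fun s =>
    hX.2 _ _ (hC.preimage (X.map s.1.2.1).hom.continuous)

/-! ### Metrics inducing a given topology -/

section Metric

variable {α : Type*} {t : TopologicalSpace α} (d : MetricSpace α)
  (h : d.toUniformSpace.toTopologicalSpace = t)
include h

theorem exists_dist_le_of_compactSpace [CompactSpace α] :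
    ∃ D : ℝ, 0 ≤ D ∧ ∀ x y : α, d.dist x y ≤ D := by
  subst h
  obtain ⟨D, hD⟩ := Metric.isBounded_iff.1 (isCompact_univ (X := α)).isBounded
  exact ⟨max D 0, le_max_right _ _, fun x y => (hD trivial trivial).trans (le_max_left _ _)⟩

theorem exists_tendsto_of_dist_le_geometric [CompactSpace α] {D c : ℝ} (hc : c < 1) {s : ℕ → α}
    (hs : ∀ n, d.dist (s n) (s (n + 1)) ≤ D * c ^ n) : ∃ l, Tendsto s atTop (𝓝 l) := by
  subst h
  exact cauchySeq_tendsto_of_complete (cauchySeq_of_le_geometric c D hc hs)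

theorem continuousAt_of_dist_lt {Z : Type*} [TopologicalSpace Z] {f : Z → α} {z : Z}
    (hf : ∀ ε > 0, ∀ᶠ y in 𝓝 z, d.dist (f y) (f z) < ε) : ContinuousAt f z := by
  subst h
  exact Metric.tendsto_nhds.2 hf

theorem eq_of_tendsto_of_tendsto {s : ℕ → α} {l l' : α} (hl : Tendsto s atTop (𝓝 l))
    (hl' : Tendsto s atTop (𝓝 l')) : l = l' := by
  subst h
  exact tendsto_nhds_unique hl hl'

end Metric

theorem eq_of_dist_le_geometric {α : Type*} (d : MetricSpace α) {D c : ℝ} (hc₀ : 0 ≤ c)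
    (hc : c < 1) {x y : α} (h : ∀ n : ℕ, d.dist x y ≤ D * c ^ n) : x = y := by
  have := (tendsto_pow_atTop_nhds_zero_of_lt_one hc₀ hc).const_mul D
  rw [mul_zero] at this
  exact dist_le_zero.1 (ge_of_tendsto' this h)

/-! ### The fixed-point operator -/

namespace EquationalSystem

variable {E : EquationalSystem A}

/-- An equational system on a finite category has finitely many sectors, so a property of ratios `< 1`
that passes to larger ratios holds uniformly. -/
theorem exists_uniform_ratio [FinCategory A] {p : ∀ b a : A, E.Sector b a → ℝ → Prop}
    (hp : ∀ b a m c c', c ≤ c' → p b a m c → p b a m c')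
    (h : ∀ b a m, ∃ c : ℝ, 0 ≤ c ∧ c < 1 ∧ p b a m c) :
    ∃ c : ℝ, 0 ≤ c ∧ c < 1 ∧ ∀ b a m, p b a m c := by
  have := fun a => (E.finite a).1
  let T := Σ a : A, (E.M.obj a).Elements
  choose r hr₀ hr₁ hr using h
  -- `none` accounts for the case without any sector.
  let f : Option T → ℝ := fun o => o.elim 0 fun s => r s.2.1.unop s.1 s.2.2
  obtain ⟨o, ho⟩ := Finite.exists_max f
  refine ⟨f o, ho none, ?_, fun b a m => hp _ _ _ _ _ (ho (some ⟨a, op b, m⟩)) (hr b a m)⟩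
  rcases o with _ | s
  · exact one_pos
  · exact hr₁ _ _ _

namespace TopCoalgebra

/-- The underlying set-valued functor of a coalgebra. -/
abbrev setFunctor (C : E.TopCoalgebra) : A ⥤ Type u := C.functor ⋙ forget TopCat.{u}

/-- The component at `a` of a natural transformation of underlying set-valued functors, as a function
between the spaces, so that continuity refers to their topologies. -/
abbrev component {C J : E.TopCoalgebra} (ω : C.setFunctor ⟶ J.setFunctor) (a : A) :
    C.functor.obj a → J.functor.obj a :=
  fun x => ω.app a x

/-- The operator `ω ↦ ψ ∘ (M ⊗ ω) ∘ ξ` on the (not necessarily continuous) natural transformations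
from a coalgebra `(C, ξ)` to a fixed point `(J, ψ⁻¹)`; its continuous fixed points are the coalgebra
maps. -/
noncomputable def step {J : E.TopCoalgebra} (hJ : J.IsFixedPoint) {C : E.TopCoalgebra}
    (ω : C.setFunctor ⟶ J.setFunctor) : C.setFunctor ⟶ J.setFunctor :=
  Functor.whiskerRight C.str (forget TopCat.{u}) ≫
    ({ app := fun a => TypeCat.ofHom (Tensor.map (𝟙 (E.M.obj a)) ω)
       naturality := fun a a' f => by
        ext t
        induction t using Tensor.ind with
        | h b m x => rfl } :
      E.tensor.obj C.functor ⋙ forget TopCat.{u} ⟶ E.tensor.obj J.functor ⋙ forget TopCat.{u}) ≫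
    Functor.whiskerRight (@inv _ _ _ _ J.str hJ) (forget TopCat.{u})

variable {J : E.TopCoalgebra} (hJ : J.IsFixedPoint) {C : E.TopCoalgebra}

theorem step_app (ω : C.setFunctor ⟶ J.setFunctor) {a b : A} {x : C.functor.obj a}
    {m : E.Sector b a} {x' : C.functor.obj b}
    (h : C.str.app a x = E.coproj C.functor m x') :
    component (step hJ ω) a x = J.sectorMap hJ m (component ω b x') := by
  change (@inv _ _ _ _ J.str hJ).app a (Tensor.map (𝟙 (E.M.obj a)) ω (C.str.app a x)) = _
  rw [h]
  rfl

theorem exists_str_app_eq (C : E.TopCoalgebra) {a : A} (x : C.functor.obj a) :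
    ∃ (b : A) (m : E.Sector b a) (x' : C.functor.obj b),
      C.str.app a x = E.coproj C.functor m x' := by
  generalize C.str.app a x = t
  induction t using Tensor.ind with
  | h b m x' => exact ⟨b, m, x', rfl⟩

/-- The coalgebra maps into a fixed point are the continuous fixed points of `step`. -/
theorem step_eq_iff (ω : C.functor ⟶ J.functor) :
    step hJ (Functor.whiskerRight ω (forget TopCat.{u})) =
        Functor.whiskerRight ω (forget TopCat.{u}) ↔
      C.str ≫ E.tensor.map ω = ω ≫ J.str := by
  have : IsIso J.str := hJ
  rw [← IsIso.comp_inv_eq]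
  constructor
  · intro h
    ext a x
    exact ConcreteCategory.congr_hom (NatTrans.congr_app h a) x
  · intro h
    ext a x
    exact ConcreteCategory.congr_hom (NatTrans.congr_app h a) x

variable (d : ∀ a : A, MetricSpace (J.functor.obj a)) {D c : ℝ}
  (hD : ∀ a x y, (d a).dist x y ≤ D) (hc₀ : 0 ≤ c) (hc : c < 1)
  (hdc : ∀ (b a : A) (m : E.Sector b a) (x y : J.functor.obj b),
    (d a).dist (J.sectorMap hJ m x) (J.sectorMap hJ m y) ≤ c * (d b).dist x y)
include hD hc₀ hc hdc

theorem eq_of_step_eq {ω ω' : C.setFunctor ⟶ J.setFunctor} (h : step hJ ω = ω)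
    (h' : step hJ ω' = ω') : ω = ω' := by
  have key : ∀ (n : ℕ) (a : A) (x : C.functor.obj a),
      (d a).dist (component ω a x) (component ω' a x) ≤ D * c ^ n := by
    intro n
    induction n with
    | zero => intro a x; simpa using hD a _ _
    | succ n ih =>
      intro a x
      obtain ⟨b, m, x', hx⟩ := C.exists_str_app_eq x
      rw [← h, ← h', step_app hJ ω hx, step_app hJ ω' hx]
      calc _ ≤ c * _ := hdc _ _ _ _ _
        _ ≤ c * (D * c ^ n) := by gcongr; exact ih b x'
        _ = _ := by ring
  ext a x
  exact eq_of_dist_le_geometric (d a) hc₀ hc fun n => key n a x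

variable (hd : ∀ a : A, (d a).toUniformSpace.toTopologicalSpace = (J.functor.obj a).str)
include hd

/-- The iterates of `step` from any `ω₀` converge pointwise to a fixed point. -/
theorem exists_step_eq (hcpt : ∀ a : A, CompactSpace (J.functor.obj a))
    (ω₀ : C.setFunctor ⟶ J.setFunctor) : ∃ ω : C.setFunctor ⟶ J.setFunctor, step hJ ω = ω := by
  let s : ℕ → (C.setFunctor ⟶ J.setFunctor) := fun n => (step hJ)^[n] ω₀
  have hs : ∀ n, s (n + 1) = step hJ (s n) := fun n => Function.iterate_succ_apply' _ _ _
  have key : ∀ (n : ℕ) (a : A) (x : C.functor.obj a),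
      (d a).dist (component (s n) a x) (component (s (n + 1)) a x) ≤ D * c ^ n := by
    intro n
    induction n with
    | zero => intro a x; simpa using hD a _ _
    | succ n ih =>
      intro a x
      obtain ⟨b, m, x', hx⟩ := C.exists_str_app_eq x
      rw [hs (n + 1), step_app hJ _ hx]
      conv_lhs => rw [hs n, step_app hJ _ hx]
      calc _ ≤ c * _ := hdc _ _ _ _ _
        _ ≤ c * (D * c ^ n) := by gcongr; rw [← hs n]; exact ih b x'
        _ = _ := by ring
  have hlim : ∀ (a : A) (x : C.functor.obj a), ∃ l : J.functor.obj a,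
      Tendsto (fun n => component (s n) a x) atTop (𝓝 l) := fun a x =>
    have := hcpt a
    exists_tendsto_of_dist_le_geometric (d a) (hd a) hc fun n => key n a x
  choose l hl using hlim
  refine ⟨{ app := fun a => TypeCat.ofHom (l a), naturality := ?_ }, ?_⟩
  · intro a b f
    ext x
    refine eq_of_tendsto_of_tendsto (d b) (hd b) (hl b (C.functor.map f x)) ?_
    refine (((J.functor.map f).hom.continuous.tendsto _).comp (hl a x)).congr fun n => ?_
    exact (ConcreteCategory.congr_hom ((s n).naturality f) x).symm
  · ext a x
    obtain ⟨b, m, x', hx⟩ := C.exists_str_app_eq x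
    refine (step_app hJ _ hx).trans ?_
    refine eq_of_tendsto_of_tendsto (d a) (hd a) ?_ ((tendsto_add_atTop_iff_nat 1).2 (hl a x))
    refine (((J.sectorMap hJ m).hom.continuous.tendsto _).comp (hl b x')).congr fun n => ?_
    rw [hs, step_app hJ _ hx]
    rfl

/-- By induction on `n`, a fixed point of `step` oscillates by at most `D * c ^ n` at every point. -/
theorem continuous_of_step_eq [FinCategory A] {ω : C.setFunctor ⟶ J.setFunctor}
    (h : step hJ ω = ω) (a : A) :
    Continuous (component ω a) := by
  have key : ∀ (n : ℕ) (a : A) (x : C.functor.obj a),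
      ∀ᶠ y in 𝓝 x, (d a).dist (component ω a y) (component ω a x) ≤ D * c ^ n := by
    intro n
    induction n with
    | zero => exact fun a x => Eventually.of_forall fun y => by simpa using hD a _ _
    | succ n ih =>
      intro a x
      have hfin := (E.finite a).1
      -- Closedness of `m ⊗ -`: near `ξ x`, the fibres of `m ⊗ -` stay near the fibre over `ξ x`.
      have hfib : ∀ s : (E.M.obj a).Elements, ∀ᶠ t in 𝓝 (C.str.app a x),
          ∀ y' ∈ E.coproj C.functor (b := s.1.unop) (a := a) s.2 ⁻¹' {t},
            ∃ x', C.str.app a x = E.coproj C.functor (b := s.1.unop) (a := a) s.2 x' ∧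
              (d s.1.unop).dist (component ω _ y') (component ω _ x') ≤ D * c ^ n := by
        intro s
        refine IsClosedMap.eventually_nhds_fiber
          (C.property.isClosedMap_topTensorCoproj (E.M.obj a) s.2) _ fun x' hx' => ?_
        filter_upwards [ih _ x'] with y' hy'
        exact ⟨x', Eq.symm hx', hy'⟩
      have hcont := (C.str.app a).hom.continuous.tendsto x
      filter_upwards [hcont.eventually (eventually_all.2 hfib)] with y hy
      obtain ⟨b, m, y', hy'⟩ := C.exists_str_app_eq y
      obtain ⟨x', hx', hle⟩ := hy ⟨op b, m⟩ y' hy'.symm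
      rw [← h, step_app hJ ω hy', step_app hJ ω hx']
      calc _ ≤ c * _ := hdc _ _ _ _ _
        _ ≤ c * (D * c ^ n) := by gcongr
        _ = _ := by ring
  refine continuous_iff_continuousAt.2 fun x => continuousAt_of_dist_lt (d a) (hd a) ?_
  intro ε hε
  have hlim := (tendsto_pow_atTop_nhds_zero_of_lt_one hc₀ hc).const_mul D
  rw [mul_zero] at hlim
  obtain ⟨n, hn⟩ := (hlim.eventually (gt_mem_nhds hε)).exists
  exact (key n a x).mono fun y hy => hy.trans_lt hn

end TopCoalgebra

end EquationalSystem

end EqSys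

open EqSys EqSys.EquationalSystem.TopCoalgebra in
theorem corollary8p5 {A : Type u} [SmallCategory A] [FinCategory A]
    (E : EqSys.EquationalSystem A) (J : E.TopCoalgebra) (hJ : J.IsFixedPoint)
    (hne : ∀ a : A, Nonempty (J.functor.obj a))
    (hcpt : ∀ a : A, CompactSpace (J.functor.obj a))
    (hcontr : J.HasContractingMetrics hJ) :
    J.IsUniversalSolution := by
  obtain ⟨d, hd, hcontr⟩ := hcontr
  obtain ⟨c, hc₀, hc, hdc⟩ := EquationalSystem.exists_uniform_ratio (E := E)
    (p := fun b a m c => ∀ x y : J.functor.obj b,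
      (d a).dist (J.sectorMap hJ m x) (J.sectorMap hJ m y) ≤ c * (d b).dist x y)
    (fun b a m c c' hcc h x y => (h x y).trans (by gcongr)) hcontr
  choose B hB₀ hB using fun a => exists_dist_le_of_compactSpace (d a) (hd a)
  have hD : ∀ a x y, (d a).dist x y ≤ ∑ a, B a := fun a x y =>
    (hB a x y).trans (Finset.single_le_sum (fun a _ => hB₀ a) (Finset.mem_univ a))
  have hex : ∀ C : E.TopCoalgebra, ∃ ω : C.functor ⟶ J.functor,
      C.str ≫ E.tensor.map ω = ω ≫ J.str := by
    intro C
    obtain ⟨ω₀⟩ := C.property.1.exists_natTrans J.setFunctor hne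
    obtain ⟨ω, hω⟩ := exists_step_eq hJ d hD hc₀ hc hdc hd hcpt ω₀
    have hcont := continuous_of_step_eq hJ d hD hc₀ hc hdc hd hω
    refine ⟨{ app := fun a => TopCat.ofHom ⟨fun x => ω.app a x, hcont a⟩, naturality := ?_ }, ?_⟩
    · intro a b f
      ext x
      exact ConcreteCategory.congr_hom (ω.naturality f) x
    · exact (step_eq_iff hJ _).1 hω
  choose ω hω using hex
  refine ⟨IsTerminal.ofUniqueHom (fun C => ObjectProperty.homMk ⟨ω C, hω C⟩) fun C f => ?_⟩
  refine ObjectProperty.hom_ext _ (Endofunctor.Coalgebra.Hom.ext ?_)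
  have heq := eq_of_step_eq hJ d hD hc₀ hc hdc
    ((step_eq_iff hJ f.hom.f).2 f.hom.h) ((step_eq_iff hJ (ω C)).2 (hω C))
  ext a x
  exact ConcreteCategory.congr_hom (NatTrans.congr_app heq a) x
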